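/- Let $\mathcal{M}$ be a class of two-armed bandit models, i.e. of pairs $\nu=(\nu_1,\nu_2)$ of probability distributions on $\mathbb{R}$ with finite expectations $\mu_1,\mu_2$, such that $\mu_1\neq\mu_2$ for every $\nu\in\mathcal{M}$. Write $a^*(\nu)$ for the arm with the larger expectation. Assume that $\mathcal{M}$ is identifiable: there is a set $\mathcal{N}$ of probability distributions containing $\nu_1,\nu_2$ for every $\nu\in\mathcal{M}$ and such that $0<\mathrm{KL}(p,q)<+\infty$ for all distinct $p,q\in\mathcal{N}$, where $\mathrm{KL}$ is the Kullback--Leibler divergence. A strategy chooses at each time $t\geq 1$ an arm $A_t\in\{1,2\}$ which is $\mathcal{F}_{t-1}$-measurable, and receives an independent draw $Z_t$ from $\nu_{A_t}$, where $\mathcal{F}_t=\sigma(A_1,Z_1,\dots,A_t,Z_t)$; it stops at a stopping time $\tau$ of $(\mathcal{F}_t)$, with $\mathbb{P}_\nu(\tau<\infty)=1$ for all $\nu\in\mathcal{M}$, and recommends an $\mathcal{F}_\tau$-measurable arm $\hat a\in\{1,2\}$. It uses uniform sampling if the arms are sampled in a round-robin fashion, i.e. alternately ($A_{t+1}\ne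 A_t$ for all $t$). Let $\nu\in\mathcal{M}$ be such that $\mu_1>\mu_2$. (Fixed budget.) Consider a fixed-budget algorithm, i.e. for every $t$ a strategy with $\tau=t$ almost surely under every model of $\mathcal{M}$, and let $p_t(\nu')=\mathbb{P}_{\nu'}(\hat a\neq a^*(\nu'))$ be its probability of error. If it uses uniform sampling and is consistent, i.e. $p_t(\nu')\to0$ as $t\to\infty$ for every $\nu'\in\mathcal{M}$, then $$\limsup_{t\to\infty}-\frac1t\log p_t(\nu)\leq I^*(\nu),\qquad I^*(\nu):=\inf_{(\nu_1',\nu_2')\in\mathcal{M}:\,\mu_1'<\mu_2'}\frac{\mathrm{KL}(\nu_1',\nu_1)+\mathrm{KL}(\nu_2',\nu_2)}{2}.$$ (Fixed confidence.) Let $0<\delta\leq0.15$. Consider a strategy that is $\delta$-PAC on $\mathcal{M}$, i.e. $\mathbb{P}_{\nu'}(\hat a=a^*(\nu'))\geq1-\delta$ for every $\nu'\in\mathcal{M}$, and that uses uniform sampling in pairs, i.e. it uses uniform sampling and under every model of $\mathcal{M}$ the total number of draws $\tau$ is almost surely even, so that each arm is drawn $\tau/2$ times. Then $$\mathbb{E}_\nu[\tau]\geq\frac{1}{I_*(\nu)}\log\frac{1}{2\delta},\qquad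 I_*(\nu):=\inf_{(\nu_1',\nu_2')\in\mathcal{M}:\,\mu_1'<\mu_2'}\frac{\mathrm{KL}(\nu_1,\nu_1')+\mathrm{KL}(\nu_2,\nu_2')}{2}.$$ Here an infimum over the empty set is $+\infty$, $-\log 0=+\infty$, $1/\infty=0$ and $1/0=+\infty$. -/

import Mathlib

open MeasureTheory ProbabilityTheory Filter InformationTheory
open scoped ENNReal

/-- A two-armed bandit model: two probability distributions on `ℝ` having an expectation.
The arms "1" and "2" are the elements `0` and `1` of `Fin 2`. -/
structure BanditModel where
  /-- the distribution `ν_a` of each arm -/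
  arm : Fin 2 → ProbabilityMeasure ℝ
  integrable_id : ∀ a, Integrable (fun x : ℝ => x) (arm a : Measure ℝ)

namespace BanditModel

/-- The expectation `μ_a` of arm `a`. -/
noncomputable def mean (ν : BanditModel) (a : Fin 2) : ℝ := ∫ x, x ∂(ν.arm a : Measure ℝ)

/-- The arm with the highest expectation (it is unique when the two expectations differ). -/
noncomputable def bestArm (ν : BanditModel) : Fin 2 :=
  open Classical in if ν.mean 1 < ν.mean 0 then 0 else 1

/-- Kullback-Leibler divergence `KL(ν_a, ν'_a)` between the distributions of arm `a` in two
models. -/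
noncomputable def armKL (ν ν' : BanditModel) (a : Fin 2) : ℝ≥0∞ :=
  klDiv (ν.arm a : Measure ℝ) (ν'.arm a : Measure ℝ)

/-- The arm distributions as a Markov kernel from arms to observations. -/
noncomputable def kernel (ν : BanditModel) : Kernel (Fin 2) ℝ :=
  Kernel.ofFunOfCountable (fun a => (ν.arm a : Measure ℝ))

instance (ν : BanditModel) : IsMarkovKernel ν.kernel :=
  ⟨fun a => inferInstanceAs (IsProbabilityMeasure (ν.arm a : Measure ℝ))⟩

/-- In every model of the class the two arms have different expectations. -/
def HasUniqueBestArm (M : Set BanditModel) : Prop :=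
  ∀ ν ∈ M, ν.mean 0 ≠ ν.mean 1

/-- Identifiable class: all the arm distributions lie in a set `N` of probability distributions
such that `0 < KL(p, q) < ∞` for all distinct `p, q ∈ N`. -/
def Identifiable (M : Set BanditModel) : Prop :=
  ∃ N : Set (ProbabilityMeasure ℝ),
    (∀ ν ∈ M, ∀ a, ν.arm a ∈ N) ∧
      ∀ p ∈ N, ∀ q ∈ N, p ≠ q →
        0 < klDiv (p : Measure ℝ) (q : Measure ℝ) ∧ klDiv (p : Measure ℝ) (q : Measure ℝ) < ∞

/-- `I^*(ν)`, the infimum over the models `ν'` of the class with `μ'_1 < μ'_2` of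
`(KL(ν'_1, ν_1) + KL(ν'_2, ν_2)) / 2`. It is `∞` if there is no such model. -/
noncomputable def upperI (M : Set BanditModel) (ν : BanditModel) : ℝ≥0∞ :=
  ⨅ ν' ∈ {ν' ∈ M | ν'.mean 0 < ν'.mean 1}, (ν'.armKL ν 0 + ν'.armKL ν 1) / 2

/-- `I_*(ν)`, the infimum over the models `ν'` of the class with `μ'_1 < μ'_2` of
`(KL(ν_1, ν'_1) + KL(ν_2, ν'_2)) / 2`. It is `∞` if there is no such model. -/
noncomputable def lowerI (M : Set BanditModel) (ν : BanditModel) : ℝ≥0∞ :=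
  ⨅ ν' ∈ {ν' ∈ M | ν'.mean 0 < ν'.mean 1}, (ν.armKL ν' 0 + ν.armKL ν' 1) / 2

end BanditModel

/-- The first `t` observations `Z_1, …, Z_t`; a point `ω : ℕ → ℝ` is the sequence of all the
observations, with `Z_{s+1} = ω s`. -/
def firstObs (t : ℕ) (ω : ℕ → ℝ) : Fin t → ℝ := fun i => ω i

lemma measurable_firstObs (t : ℕ) : Measurable (firstObs t) :=
  measurable_pi_lambda _ fun i => measurable_pi_apply (i : ℕ)

/-- The information available after `t` draws, `F_t = σ(Z_1, …, Z_t)`. It is also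
`σ(A_1, Z_1, …, A_t, Z_t)`, since the arm `A_{s+1}` is a measurable function of
`Z_1, …, Z_s`. -/
def obsFiltration : Filtration ℕ (inferInstance : MeasurableSpace (ℕ → ℝ)) where
  seq t := MeasurableSpace.comap (firstObs t) inferInstance
  mono' := by
    intro s t hst
    have h : firstObs s = (fun z (i : Fin s) => z (Fin.castLE hst i)) ∘ firstObs t := rfl
    have hm : Measurable (fun (z : Fin t → ℝ) (i : Fin s) => z (Fin.castLE hst i)) :=
      measurable_pi_lambda _ fun i => measurable_pi_apply _
    change MeasurableSpace.comap (firstObs s) _ ≤ MeasurableSpace.comap (firstObs t) _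
    rw [h, ← MeasurableSpace.comap_comp]
    exact MeasurableSpace.comap_mono hm.comap_le
  le' t := (measurable_firstObs t).comap_le

/-- A strategy `((A_t), τ, â)`: a sampling rule, a stopping rule and a recommendation rule. -/
structure Strategy where
  /-- sampling rule: `sample t (Z_1, …, Z_t)` is the arm `A_{t+1}` -/
  sample : (t : ℕ) → (Fin t → ℝ) → Fin 2
  measurable_sample : ∀ t, Measurable (sample t)
  /-- stopping rule `τ`, the total number of draws -/
  tau : (ℕ → ℝ) → ℕ∞
  isStoppingTime_tau : IsStoppingTime obsFiltration tau
  /-- recommended arm `â` -/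
  recommend : (ℕ → ℝ) → Fin 2
  measurable_recommend : Measurable[isStoppingTime_tau.measurableSpace] recommend

namespace Strategy

/-- The arm `A_{t+1}`, as a function of the sequence of observations. -/
def draw (S : Strategy) (t : ℕ) (ω : ℕ → ℝ) : Fin 2 := S.sample t (firstObs t ω)

/-- The arm `A_{n+2}`, as a function of the observations `Z_1, …, Z_{n+1}`. -/
def nextArm (S : Strategy) (n : ℕ) (h : (i : Finset.Iic n) → (fun _ : ℕ => ℝ) i) : Fin 2 :=
  S.sample (n + 1) fun i => h ⟨i, Finset.mem_Iic.2 (Nat.lt_succ_iff.1 i.2)⟩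

lemma measurable_nextArm (S : Strategy) (n : ℕ) : Measurable (S.nextArm n) :=
  (S.measurable_sample (n + 1)).comp (measurable_pi_lambda _ fun _ => measurable_pi_apply _)

/-- `P_ν`, the law of the sequence of observations when the strategy faces the model `ν`:
given the past, the next observation is drawn from the distribution of the arm chosen by the
sampling rule. -/
noncomputable def law (S : Strategy) (ν : BanditModel) : Measure (ℕ → ℝ) :=
  Kernel.trajMeasure (X := fun _ => ℝ) (ν.kernel (S.sample 0 Fin.elim0))
    fun n => ν.kernel.comap (S.nextArm n) (S.measurable_nextArm n)

/-- The stopping rule is finite almost surely under every model of the class. -/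
def TerminatesOn (S : Strategy) (M : Set BanditModel) : Prop :=
  ∀ ν ∈ M, ∀ᵐ ω ∂(S.law ν), S.tau ω < ⊤

/-- The number of draws is `t`, almost surely under every model of the class. -/
def HasBudget (S : Strategy) (M : Set BanditModel) (t : ℕ) : Prop :=
  ∀ ν ∈ M, ∀ᵐ ω ∂(S.law ν), S.tau ω = t

/-- Uniform sampling: the two arms are sampled in a round-robin fashion, one after the other. -/
def SamplesUniformly (S : Strategy) : Prop :=
  ∀ t ω, S.draw (t + 1) ω ≠ S.draw t ω

/-- The number of draws is even, that is, the strategy ends after a whole number of pairs of draws (almost surely under every model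
of the class), so that under uniform sampling each arm is drawn `τ / 2` times. -/
def StopsAfterPairs (S : Strategy) (M : Set BanditModel) : Prop :=
  ∀ ν ∈ M, ∀ᵐ ω ∂(S.law ν), ∃ k : ℕ, S.tau ω = ((2 * k : ℕ) : ℕ∞)

/-- `P_ν(â ≠ a^*)`. -/
noncomputable def errorProb (S : Strategy) (ν : BanditModel) : ℝ≥0∞ :=
  S.law ν {ω | S.recommend ω ≠ ν.bestArm}

/-- `δ`-PAC: `P_ν(â = a^*) ≥ 1 - δ` for every model `ν` of the class. -/
def IsPAC (S : Strategy) (M : Set BanditModel) (δ : ℝ) : Prop :=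
  ∀ ν ∈ M, ENNReal.ofReal (1 - δ) ≤ S.law ν {ω | S.recommend ω = ν.bestArm}

/-- `E_ν[τ]`. -/
noncomputable def expectedStop (S : Strategy) (ν : BanditModel) : ℝ≥0∞ :=
  ∫⁻ ω, (S.tau ω : ℝ≥0∞) ∂(S.law ν)

end Strategy

/-- A fixed-budget algorithm on the class: for every budget `t`, a strategy making `t` draws. -/
def IsFixedBudget (S : ℕ → Strategy) (M : Set BanditModel) : Prop :=
  ∀ t, (S t).HasBudget M t

/-- Consistency of a fixed-budget algorithm: `p_t(ν) → 0` for every model `ν` of the class. -/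
def IsConsistent (S : ℕ → Strategy) (M : Set BanditModel) : Prop :=
  ∀ ν ∈ M, Tendsto (fun t => (S t).errorProb ν) atTop (nhds 0)

/-! Both bounds come from one change of measure inequality. Under uniform sampling the arm drawn at
each time does not depend on the observations, so under every model the observations are
independent (`Strategy.SamplesUniformly.isDrawnFrom_law`). Let `P` and `Q` be the laws of the
observations under two models, and `A` an event of `F_τ`. For every real `l`,

`l P(A ∩ {τ ≤ t}) ≤ log (1 + (e^l - 1) Q(A ∩ {τ ≤ t})) + ∑ s < t, P(τ > s) KL(p_s, q_s)`,

where `p_s`, `q_s` are the distributions of the observation of index `s`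
(`IsDrawnFrom.mul_measureReal_le`). This is the Donsker-Varadhan inequality for the test function
`l 1_{A ∩ {τ ≤ t}}`. It is proved by induction on `t`, integrating out the last observation: this
costs one divergence if the observation is made, and nothing after the stopping time, where the
test function no longer depends on it (`IsDrawnFrom.integral_le_log_integral_exp`). Likelihood
ratios of the whole sequence, Wald's identity and integrability questions are avoided in this way.

For a fixed budget, `P` is the law under an alternative `ν'`, `Q` the law under `ν` and `A` the
event that arm 2 is recommended, so that `Q(A) = p_t(ν)` and `P(A) → 1`. With `l = -log p_t(ν)` the
inequality bounds `-P(A) log p_t(ν)` by `log 2` plus the divergences of `t` draws, about `t / 2`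
from each arm. For a fixed confidence, `P` is the law under `ν`, `Q` the law under `ν'` and `A` the
event that arm 1 is recommended, so that `P(A) ≥ 1 - δ` and `Q(A) ≤ δ`. As `τ` is even, the sum of
divergences is at most `E[τ] / 2` times the divergence of one pair of draws. The optimal `l` and
`t → ∞` give the relative entropy `(1 - 2δ) log ((1 - δ) / δ)` as a lower bound for it, and this is
at least `log (1 / (2δ))` for `δ ≤ 0.15` (`log_one_div_two_mul_le`). -/

/-! ### Independent observations and the change of measure inequality -/

/-- One half of the Donsker-Varadhan variational formula, for bounded test functions. -/
lemma integral_le_log_integral_exp_add_klDiv {α : Type*} [MeasurableSpace α]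
    (μ ν : Measure α) [IsProbabilityMeasure μ] [IsProbabilityMeasure ν]
    (hKL : klDiv μ ν ≠ ∞) {f : α → ℝ} (hf : Measurable f) {b : ℝ} (hb : ∀ x, |f x| ≤ b) :
    ∫ x, f x ∂μ ≤ Real.log (∫ x, Real.exp (f x) ∂ν) + (klDiv μ ν).toReal := by
  obtain ⟨hac, hint⟩ := klDiv_ne_top_iff.1 hKL
  have hfμ : Integrable f μ :=
    .of_bound hf.aestronglyMeasurable b (ae_of_all _ fun x => by simpa using hb x)
  have hfν : Integrable (fun x => Real.exp (f x)) ν :=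
    .of_bound hf.exp.aestronglyMeasurable (Real.exp b) (ae_of_all _ fun x => by
      simpa using (abs_le.1 (hb x)).2)
  have := isProbabilityMeasure_tilted hfν
  -- Gibbs' inequality between `μ` and the tilted measure `e^f ν / ∫ e^f dν`
  have h := integral_llr_add_sub_measure_univ_nonneg
    (hac.trans (absolutelyContinuous_tilted hfν)) (integrable_llr_tilted_right hac hfμ hint hfν)
  rw [integral_llr_tilted_right hac hfμ hfν hint] at h
  rw [toReal_klDiv hac hint]
  simp only [probReal_univ] at h ⊢
  linarith

/-- `P` is the law of a sequence of independent observations, in which the observation of index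
`t` (counted from zero) has the distribution `p t`. Independence is stated one observation at a
time, given the earlier ones. -/
def IsDrawnFrom (P : Measure (ℕ → ℝ)) (p : ℕ → Measure ℝ) : Prop :=
  ∀ t, P.map (fun ω => (firstObs t ω, ω t)) = (P.map (firstObs t)).prod (p t)

lemma firstObs_eq_iff {t : ℕ} {ω ω' : ℕ → ℝ} :
    firstObs t ω = firstObs t ω' ↔ ∀ i < t, ω i = ω' i :=
  ⟨fun h i hi => congrFun h ⟨i, hi⟩, fun h => funext fun i => h i i.2⟩

lemma firstObs_eq_of_le {s t : ℕ} (hst : s ≤ t) {ω ω' : ℕ → ℝ}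
    (h : firstObs t ω = firstObs t ω') : firstObs s ω = firstObs s ω' :=
  firstObs_eq_iff.2 fun i hi => firstObs_eq_iff.1 h i (hi.trans_le hst)

lemma firstObs_update {t : ℕ} (ω : ℕ → ℝ) (x : ℝ) :
    firstObs t (Function.update ω t x) = firstObs t ω :=
  firstObs_eq_iff.2 fun _ hi => Function.update_of_ne hi.ne _ _

/-- An event of `F_t` depends on the first `t` observations only. -/
lemma mem_iff_of_firstObs_eq {t : ℕ} {A : Set (ℕ → ℝ)} (hA : MeasurableSet[obsFiltration t] A)
    {ω ω' : ℕ → ℝ} (h : firstObs t ω = firstObs t ω') : ω ∈ A ↔ ω' ∈ A := by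
  obtain ⟨B, -, rfl⟩ := hA
  simp [h]

lemma measurableSet_lt_of_isStoppingTime {τ : (ℕ → ℝ) → ℕ∞}
    (hτ : IsStoppingTime obsFiltration τ) (t : ℕ) : MeasurableSet {ω | (t : ℕ∞) < τ ω} := by
  have h := (obsFiltration.le t _ (hτ t)).compl
  convert h using 1
  ext ω
  exact (not_le (a := τ ω) (b := (t : ℕ∞))).symm

/-- Resampling the observation of index `t` does not change the expectation of a function of the
first `t + 1` observations. -/
lemma IsDrawnFrom.integral_integral_update {P : Measure (ℕ → ℝ)} [IsProbabilityMeasure P]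
    {p : ℕ → Measure ℝ} [∀ t, IsProbabilityMeasure (p t)] (hP : IsDrawnFrom P p) (t : ℕ)
    {F : (ℕ → ℝ) → ℝ} (hF : Measurable F) {b : ℝ} (hb : ∀ ω, |F ω| ≤ b)
    (hdep : ∀ ω ω', firstObs (t + 1) ω = firstObs (t + 1) ω' → F ω = F ω') :
    ∫ ω, ∫ x, F (Function.update ω t x) ∂(p t) ∂P = ∫ ω, F ω ∂P := by
  let e : (Fin t → ℝ) × ℝ → ℕ → ℝ := fun z i => if h : i < t then z.1 ⟨i, h⟩ else z.2
  have he : Measurable e := measurable_pi_lambda _ fun i => by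
    by_cases h : i < t <;> simp only [e, h, dite_true, dite_false] <;> fun_prop
  have hm := measurable_firstObs t
  have hprob : IsProbabilityMeasure (P.map (firstObs t)) :=
    Measure.isProbabilityMeasure_map hm.aemeasurable
  have heq : ∀ ω x, F (e (firstObs t ω, x)) = F (Function.update ω t x) := fun ω x =>
    hdep _ _ (firstObs_eq_iff.2 fun i hi => by
      rcases Nat.lt_succ_iff_lt_or_eq.1 hi with h | rfl
      · simp [e, h, h.ne, firstObs]
      · simp [e])
  have hFe : Measurable (fun z => F (e z)) := hF.comp he
  calc ∫ ω, ∫ x, F (Function.update ω t x) ∂(p t) ∂P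
      = ∫ ω, ∫ x, F (e (firstObs t ω, x)) ∂(p t) ∂P := by simp_rw [heq]
    _ = ∫ z, ∫ x, F (e (z, x)) ∂(p t) ∂(P.map (firstObs t)) := by
        rw [integral_map hm.aemeasurable]
        exact (hFe.stronglyMeasurable.integral_prod_right).aestronglyMeasurable
    _ = ∫ z, F (e z) ∂(P.map (fun ω => (firstObs t ω, ω t))) := by
        rw [hP t, integral_prod]
        exact .of_bound hFe.aestronglyMeasurable b (ae_of_all _ fun z => by simpa using hb _)
    _ = ∫ ω, F ω ∂P := by
        rw [integral_map (by fun_prop) hFe.aestronglyMeasurable]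
        simp_rw [heq, Function.update_eq_self]

/-- Donsker-Varadhan bound for sequential observations: for a bounded function `G` of the
observations made before `min τ t`, the expectation under `P` exceeds the log-exponential moment
under `Q` by at most `∑ s < t, P(τ > s) KL(p s, q s)`. -/
lemma IsDrawnFrom.integral_le_log_integral_exp {P Q : Measure (ℕ → ℝ)} [IsProbabilityMeasure P]
    [IsProbabilityMeasure Q] {p q : ℕ → Measure ℝ} [∀ t, IsProbabilityMeasure (p t)]
    [∀ t, IsProbabilityMeasure (q t)] (hP : IsDrawnFrom P p) (hQ : IsDrawnFrom Q q)
    (hKL : ∀ t, klDiv (p t) (q t) ≠ ∞) {τ : (ℕ → ℝ) → ℕ∞} (hτ : IsStoppingTime obsFiltration τ)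
    (t : ℕ) {G : (ℕ → ℝ) → ℝ} (hG : Measurable G) {b : ℝ} (hb : ∀ ω, |G ω| ≤ b)
    (hdep : ∀ (s : ℕ) ω ω', τ ω ≤ s ∨ t ≤ s → firstObs s ω = firstObs s ω' → G ω = G ω') :
    ∫ ω, G ω ∂P ≤ Real.log (∫ ω, Real.exp (G ω) ∂Q) +
      ∑ s ∈ Finset.range t, P.real {ω | (s : ℕ∞) < τ ω} * (klDiv (p s) (q s)).toReal := by
  induction t generalizing G with
  | zero =>
    have hc : ∀ ω, G ω = G 0 := fun ω => hdep 0 _ _ (.inr le_rfl) (funext fun i => i.elim0)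
    simp [hc]
  | succ t ih =>
    set H : (ℕ → ℝ) → ℝ :=
      fun ω => Real.log (∫ x, Real.exp (G (Function.update ω t x)) ∂(q t)) with hH
    have hup : Measurable fun z : (ℕ → ℝ) × ℝ => G (Function.update z.1 t z.2) :=
      hG.comp measurable_update'
    have hGω : ∀ ω, Measurable fun x => G (Function.update ω t x) := fun ω =>
      hup.comp measurable_prodMk_left
    have hint : ∀ ω, Integrable (fun x => Real.exp (G (Function.update ω t x))) (q t) := fun ω =>
      .of_bound (hGω ω).exp.aestronglyMeasurable (Real.exp b) (ae_of_all _ fun x => by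
        simpa using (abs_le.1 (hb _)).2)
    have hlow : ∀ ω, Real.exp (-b) ≤ ∫ x, Real.exp (G (Function.update ω t x)) ∂(q t) := fun ω => by
      have := integral_mono (integrable_const (Real.exp (-b))) (hint ω) fun x =>
        Real.exp_le_exp.2 (abs_le.1 (hb (Function.update ω t x))).1
      simpa using this
    have hupp : ∀ ω, ∫ x, Real.exp (G (Function.update ω t x)) ∂(q t) ≤ Real.exp b := fun ω => by
      have := integral_mono (hint ω) (integrable_const (Real.exp b)) fun x =>
        Real.exp_le_exp.2 (abs_le.1 (hb (Function.update ω t x))).2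
      simpa using this
    have hpos : ∀ ω, 0 < ∫ x, Real.exp (G (Function.update ω t x)) ∂(q t) := fun ω =>
      (Real.exp_pos _).trans_le (hlow ω)
    have hHm : Measurable H :=
      (hup.exp.stronglyMeasurable.integral_prod_right (ν := q t)).measurable.log
    have hHb : ∀ ω, |H ω| ≤ b := fun ω => abs_le.2
      ⟨(Real.le_log_iff_exp_le (hpos ω)).2 (hlow ω), (Real.log_le_iff_le_exp (hpos ω)).2 (hupp ω)⟩
    have htau : ∀ (s : ℕ) ω ω', firstObs s ω = firstObs s ω' → τ ω ≤ s → τ ω' ≤ s :=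
      fun s ω ω' h => (mem_iff_of_firstObs_eq (hτ s) h).1
    have hHdep : ∀ (s : ℕ) ω ω', τ ω ≤ s ∨ t ≤ s → firstObs s ω = firstObs s ω' → H ω = H ω' := by
      intro s ω ω' hs h
      suffices ∀ x, G (Function.update ω t x) = G (Function.update ω' t x) by simp [hH, this]
      intro x
      rcases le_or_gt t s with hts | hst
      · refine hdep (t + 1) _ _ (.inr le_rfl) (firstObs_eq_iff.2 fun i hi => ?_)
        rcases Nat.lt_succ_iff_lt_or_eq.1 hi with h' | rfl
        · simpa [h'.ne] using firstObs_eq_iff.1 h i (h'.trans_le hts)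
        · simp
      · have h1 := firstObs_eq_of_le hst.le (firstObs_update (t := t) ω x)
        have h2 := firstObs_eq_of_le hst.le (firstObs_update (t := t) ω' x)
        exact hdep s _ _ (.inl (htau s _ _ h1.symm (hs.resolve_right hst.not_ge)))
          (h1.trans (h.trans h2.symm))
    have hset := measurableSet_lt_of_isStoppingTime hτ t
    set K := (klDiv (p t) (q t)).toReal with hK
    -- the observation of index `t` costs `K` if it is made, and nothing if `τ ≤ t`
    have hstep : ∀ ω, ∫ x, G (Function.update ω t x) ∂(p t) ≤
        H ω + {ω | (t : ℕ∞) < τ ω}.indicator (fun _ => K) ω := by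
      intro ω
      by_cases hω : (t : ℕ∞) < τ ω
      · rw [Set.indicator_of_mem (by exact hω)]
        exact integral_le_log_integral_exp_add_klDiv _ _ (hKL t) (hGω ω) fun x => hb _
      · rw [Set.indicator_of_notMem (by exact hω)]
        have hc : ∀ x, G (Function.update ω t x) = G ω := fun x =>
          (hdep t _ _ (.inl (not_lt.1 hω)) (firstObs_update ω x).symm).symm
        simp [hH, hc]
    have hdep' : ∀ ω ω', firstObs (t + 1) ω = firstObs (t + 1) ω' → G ω = G ω' :=
      fun ω ω' => hdep (t + 1) ω ω' (.inr le_rfl)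
    have hHint : Integrable H P := .of_bound hHm.aestronglyMeasurable b (ae_of_all _ hHb)
    have hind : Integrable ({ω | (t : ℕ∞) < τ ω}.indicator fun _ => K) P :=
      (integrable_const K).indicator hset
    have hPG := hP.integral_integral_update t hG hb hdep'
    have hQG := hQ.integral_integral_update t (F := fun ω => Real.exp (G ω)) hG.exp
      (b := Real.exp b) (fun ω => by simpa using (abs_le.1 (hb _)).2)
      (fun ω ω' h => by rw [hdep' ω ω' h])
    calc ∫ ω, G ω ∂P = ∫ ω, ∫ x, G (Function.update ω t x) ∂(p t) ∂P := hPG.symm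
      _ ≤ ∫ ω, (H ω + {ω | (t : ℕ∞) < τ ω}.indicator (fun _ => K) ω) ∂P := by
          refine integral_mono ?_ (hHint.add hind) hstep
          refine .of_bound
            (hup.stronglyMeasurable.integral_prod_right (ν := p t)).aestronglyMeasurable b
            (ae_of_all _ fun ω => ?_)
          have := norm_integral_le_of_norm_le_const (μ := p t)
            (f := fun x => G (Function.update ω t x)) (ae_of_all _ fun x => hb _)
          simpa using this
      _ = ∫ ω, H ω ∂P + P.real {ω | (t : ℕ∞) < τ ω} * K := by
          rw [integral_add hHint hind, integral_indicator_const _ hset, smul_eq_mul]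
      _ ≤ Real.log (∫ ω, Real.exp (H ω) ∂Q) + ∑ s ∈ Finset.range t,
            P.real {ω | (s : ℕ∞) < τ ω} * (klDiv (p s) (q s)).toReal +
            P.real {ω | (t : ℕ∞) < τ ω} * K := by
          gcongr
          exact ih hHm hHb hHdep
      _ = _ := by
          rw [Finset.sum_range_succ, ← add_assoc, ← hQG]
          simp only [hH, Real.exp_log (hpos _), hK]

/-- A change of measure inequality: by convex duality in `l`, the bound says that the relative
entropy of the two Bernoulli distributions with parameters `P(A ∩ {τ ≤ t})` and
`Q(A ∩ {τ ≤ t})` is at most the divergence of the observations made before `min τ t`. -/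
lemma IsDrawnFrom.mul_measureReal_le {P Q : Measure (ℕ → ℝ)} [IsProbabilityMeasure P]
    [IsProbabilityMeasure Q] {p q : ℕ → Measure ℝ} [∀ t, IsProbabilityMeasure (p t)]
    [∀ t, IsProbabilityMeasure (q t)] (hP : IsDrawnFrom P p) (hQ : IsDrawnFrom Q q)
    (hKL : ∀ t, klDiv (p t) (q t) ≠ ∞) {τ : (ℕ → ℝ) → ℕ∞} (hτ : IsStoppingTime obsFiltration τ)
    {A : Set (ℕ → ℝ)} (hA : MeasurableSet[hτ.measurableSpace] A) (t : ℕ) (l : ℝ) :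
    l * P.real (A ∩ {ω | τ ω ≤ t}) ≤
      Real.log (1 + (Real.exp l - 1) * Q.real (A ∩ {ω | τ ω ≤ t})) +
      ∑ s ∈ Finset.range t, P.real {ω | (s : ℕ∞) < τ ω} * (klDiv (p s) (q s)).toReal := by
  set B := A ∩ {ω | τ ω ≤ t} with hB
  have hBm : MeasurableSet B := obsFiltration.le t _ (hA.2 t)
  have hdep : ∀ (s : ℕ) ω ω', τ ω ≤ s ∨ t ≤ s → firstObs s ω = firstObs s ω' →
      (ω ∈ B ↔ ω' ∈ B) := by
    intro s ω ω' hs h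
    rcases le_or_gt t s with hts | hst
    · exact mem_iff_of_firstObs_eq (hA.2 t) (firstObs_eq_of_le hts h)
    · have h1 : τ ω ≤ s := hs.resolve_right hst.not_ge
      have h2 : τ ω' ≤ s := (mem_iff_of_firstObs_eq (hτ s) h).1 h1
      have h3 := mem_iff_of_firstObs_eq (hA.2 s) h
      have hle : (s : ℕ∞) ≤ t := by exact_mod_cast hst.le
      have e1 : ω ∈ B ↔ ω ∈ A ∩ {ω | τ ω ≤ s} :=
        and_congr_right fun _ => iff_of_true (h1.trans hle) h1
      have e2 : ω' ∈ B ↔ ω' ∈ A ∩ {ω | τ ω ≤ s} :=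
        and_congr_right fun _ => iff_of_true (h2.trans hle) h2
      exact e1.trans (h3.trans e2.symm)
  have key := hP.integral_le_log_integral_exp hQ hKL hτ t (G := B.indicator fun _ => l)
    (measurable_const.indicator hBm) (b := |l|)
    (fun ω => by by_cases h : ω ∈ B <;> simp [h])
    (fun s ω ω' hs h => by
      have := hdep s ω ω' hs h
      by_cases h' : ω ∈ B
      · rw [Set.indicator_of_mem h', Set.indicator_of_mem (this.1 h')]
      · rw [Set.indicator_of_notMem h', Set.indicator_of_notMem (mt this.2 h')])
  have hexp : ∀ ω, Real.exp (B.indicator (fun _ => l) ω) =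
      1 + B.indicator (fun _ => Real.exp l - 1) ω := fun ω => by
    by_cases h : ω ∈ B <;> simp [h]
  rw [integral_indicator_const _ hBm] at key
  simp_rw [hexp] at key
  rw [integral_add (integrable_const _) ((integrable_const _).indicator hBm),
    integral_indicator_const _ hBm] at key
  simpa [mul_comm] using key

/-! ### The observations under uniform sampling -/

namespace Strategy

/-- The arm drawn at each time by a strategy with uniform sampling. It does not depend on the
observations, so it can be read off the null sequence of observations. -/
def arms (S : Strategy) (t : ℕ) : Fin 2 := S.draw t 0

lemma SamplesUniformly.draw_eq {S : Strategy} (h : S.SamplesUniformly) (t : ℕ) (ω : ℕ → ℝ) :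
    S.draw t ω = S.arms t := by
  induction t with
  | zero => exact congrArg (S.sample 0) (funext fun i => i.elim0)
  | succ t ih =>
    have h1 := h t ω
    have h2 := h t 0
    rw [ih] at h1
    change _ ≠ S.arms t at h2
    change S.draw (t + 1) ω = S.draw (t + 1) 0
    omega

lemma SamplesUniformly.sample_eq {S : Strategy} (h : S.SamplesUniformly) (t : ℕ)
    (z : Fin t → ℝ) : S.sample t z = S.arms t := by
  have hz : z = firstObs t (fun i => if hi : i < t then z ⟨i, hi⟩ else 0) := by
    ext i
    simp [firstObs]
  rw [hz]
  exact h.draw_eq t _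

/-- Two consecutive draws under uniform sampling are one draw of each arm. -/
lemma SamplesUniformly.add_arms {S : Strategy} (h : S.SamplesUniformly) (t : ℕ) {R : Type*}
    [AddCommMonoid R] (f : Fin 2 → R) : f (S.arms t) + f (S.arms (t + 1)) = f 0 + f 1 := by
  have h1 : S.arms (t + 1) ≠ S.arms t := h t 0
  generalize S.arms t = a at *
  generalize S.arms (t + 1) = b at *
  fin_cases a <;> fin_cases b <;> simp_all [add_comm]

instance (S : Strategy) (ν : BanditModel) : IsProbabilityMeasure (S.law ν) := by
  unfold law
  infer_instance

lemma map_law_zero (S : Strategy) (ν : BanditModel) :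
    (S.law ν).map (fun ω => ω 0) = (ν.arm (S.arms 0) : Measure ℝ) := by
  have hs : S.sample 0 Fin.elim0 = S.arms 0 :=
    congrArg (S.sample 0) (funext fun i => i.elim0)
  let e : ((i : Finset.Iic 0) → ℝ) → ℝ := fun z => z ⟨0, Finset.mem_Iic.2 le_rfl⟩
  have he : Measurable e := measurable_pi_apply _
  have hcomp : (fun ω : ℕ → ℝ => ω 0) = e ∘ Preorder.frestrictLe (π := fun _ => ℝ) 0 := rfl
  rw [hcomp, ← Measure.map_map he (by fun_prop), law, Kernel.trajMeasure,
    Measure.map_comp _ _ (by fun_prop), Kernel.traj_map_frestrictLe, Kernel.partialTraj_self,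
    Measure.id_comp, Measure.map_map he (by fun_prop), hs]
  exact Measure.map_id

/-- Under uniform sampling the observations are independent, since the arms are deterministic. -/
lemma SamplesUniformly.isDrawnFrom_law {S : Strategy} (h : S.SamplesUniformly)
    (ν : BanditModel) : IsDrawnFrom (S.law ν) fun t => (ν.arm (S.arms t) : Measure ℝ) := by
  intro t
  cases t with
  | zero =>
    have hc : firstObs 0 = fun _ => Fin.elim0 := funext fun ω => funext fun i => i.elim0
    rw [hc, Measure.map_const, measure_univ, one_smul, Measure.dirac_prod]
    refine Eq.trans ?_ (congrArg (Measure.map (Prod.mk Fin.elim0)) (S.map_law_zero ν))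
    exact (Measure.map_map measurable_prodMk_left (measurable_pi_apply 0)).symm
  | succ n =>
    have key := Kernel.map_frestrictLe_trajMeasure_compProd_eq_map_trajMeasure (X := fun _ => ℝ)
      (μ₀ := ν.kernel (S.sample 0 Fin.elim0))
      (κ := fun n => ν.kernel.comap (S.nextArm n) (S.measurable_nextArm n)) (a := n)
    have hκ : ν.kernel.comap (S.nextArm n) (S.measurable_nextArm n) =
        Kernel.const _ (ν.arm (S.arms (n + 1)) : Measure ℝ) := by
      ext1 z
      rw [Kernel.comap_apply, Kernel.const_apply, nextArm, h.sample_eq]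
      rfl
    change ((S.law ν).map _) ⊗ₘ _ = (S.law ν).map _ at key
    rw [hκ, Measure.compProd_const] at key
    let r : ((i : Finset.Iic n) → ℝ) → Fin (n + 1) → ℝ :=
      fun z i => z ⟨i, Finset.mem_Iic.2 (Nat.lt_succ_iff.1 i.2)⟩
    have hr : Measurable r := measurable_pi_lambda _ fun i => measurable_pi_apply _
    have := congrArg (Measure.map (Prod.map r id)) key
    rw [← Measure.map_prod_map _ _ hr measurable_id, Measure.map_map hr (by fun_prop),
      Measure.map_map (hr.prodMap measurable_id) (by fun_prop), Measure.map_id] at this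
    exact this.symm

end Strategy

/-! ### Divergence bounds for uniform sampling -/

namespace BanditModel

lemma Identifiable.armKL_ne_top {M : Set BanditModel} (hM : Identifiable M) {ν ν' : BanditModel}
    (hν : ν ∈ M) (hν' : ν' ∈ M) (a : Fin 2) : ν.armKL ν' a ≠ ∞ := by
  obtain ⟨N, hN, hKL⟩ := hM
  by_cases h : ν.arm a = ν'.arm a
  · simp [armKL, h, klDiv_self]
  · exact (hKL _ (hN ν hν a) _ (hN ν' hν' a) h).2.ne

lemma bestArm_eq_zero {ν : BanditModel} (h : ν.mean 1 < ν.mean 0) : ν.bestArm = 0 := if_pos h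

lemma bestArm_eq_one {ν : BanditModel} (h : ν.mean 0 < ν.mean 1) : ν.bestArm = 1 :=
  if_neg h.not_gt

end BanditModel

namespace Strategy

lemma measurableSet_recommend_eq (S : Strategy) (a : Fin 2) :
    MeasurableSet[S.isStoppingTime_tau.measurableSpace] {ω | S.recommend ω = a} :=
  S.measurable_recommend (measurableSet_singleton a)

/-- The change of measure inequality of `IsDrawnFrom.mul_measureReal_le` for two models. -/
lemma SamplesUniformly.mul_measureReal_le {S : Strategy} (h : S.SamplesUniformly)
    {ν ν' : BanditModel} (hKL : ∀ a, ν.armKL ν' a ≠ ∞) {A : Set (ℕ → ℝ)}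
    (hA : MeasurableSet[S.isStoppingTime_tau.measurableSpace] A) (t : ℕ) (l : ℝ) :
    l * (S.law ν).real (A ∩ {ω | S.tau ω ≤ t}) ≤
      Real.log (1 + (Real.exp l - 1) * (S.law ν').real (A ∩ {ω | S.tau ω ≤ t})) +
      ∑ s ∈ Finset.range t,
        (S.law ν).real {ω | (s : ℕ∞) < S.tau ω} * (ν.armKL ν' (S.arms s)).toReal :=
  (h.isDrawnFrom_law ν).mul_measureReal_le (h.isDrawnFrom_law ν') (fun _ => hKL _)
    S.isStoppingTime_tau hA t l

lemma SamplesUniformly.sum_arms_le {S : Strategy} (h : S.SamplesUniformly) {f : Fin 2 → ℝ}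
    (hf : ∀ a, 0 ≤ f a) (t : ℕ) :
    ∑ s ∈ Finset.range t, f (S.arms s) ≤ ((t : ℝ) + 1) / 2 * (f 0 + f 1) := by
  have heven : ∀ n : ℕ, ∑ s ∈ Finset.range (2 * n), f (S.arms s) = n * (f 0 + f 1) := by
    intro n
    induction n with
    | zero => simp
    | succ n ih =>
      rw [mul_add_one, Finset.sum_range_succ, Finset.sum_range_succ, ih, add_assoc, h.add_arms]
      push_cast
      ring
  calc ∑ s ∈ Finset.range t, f (S.arms s)
      ≤ ∑ s ∈ Finset.range (2 * ((t + 1) / 2)), f (S.arms s) :=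
        Finset.sum_le_sum_of_subset_of_nonneg (Finset.range_subset_range.2 (by omega))
          fun _ _ _ => hf _
    _ = ((t + 1) / 2 : ℕ) * (f 0 + f 1) := heven _
    _ ≤ _ := by
        gcongr
        · exact add_nonneg (hf 0) (hf 1)
        · exact_mod_cast Nat.cast_div_le (α := ℝ) (m := t + 1) (n := 2)

/-- With a budget of `t` draws, an event which is likely under `ν'` cannot have probability zero
under `ν`, and the logarithm of its probability is at least of order `-t / 2` times the
divergence between the models. -/
lemma SamplesUniformly.neg_log_measureReal_le {S : Strategy} (h : S.SamplesUniformly)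
    {ν ν' : BanditModel} (hKL : ∀ a, ν'.armKL ν a ≠ ∞) {A : Set (ℕ → ℝ)}
    (hA : MeasurableSet[S.isStoppingTime_tau.measurableSpace] A) {t : ℕ}
    (hν : ∀ᵐ ω ∂(S.law ν), S.tau ω = t) (hν' : ∀ᵐ ω ∂(S.law ν'), S.tau ω = t)
    (hpos : 0 < (S.law ν').real A) :
    0 < (S.law ν).real A ∧
      (S.law ν').real A * -Real.log ((S.law ν).real A) ≤
        Real.log 2 + ((t : ℝ) + 1) / 2 * ((ν'.armKL ν 0).toReal + (ν'.armKL ν 1).toReal) := by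
  have hset : ∀ (P : Measure (ℕ → ℝ)), (∀ᵐ ω ∂P, S.tau ω = t) →
      P.real (A ∩ {ω | S.tau ω ≤ t}) = P.real A := by
    intro P hP
    refine measureReal_congr ?_
    filter_upwards [hP] with ω hω
    exact propext (and_iff_left hω.le)
  set C := ((t : ℝ) + 1) / 2 * ((ν'.armKL ν 0).toReal + (ν'.armKL ν 1).toReal) with hC
  have key : ∀ l, l * (S.law ν').real A ≤
      Real.log (1 + (Real.exp l - 1) * (S.law ν).real A) + C := by
    intro l
    have h1 := h.mul_measureReal_le hKL hA t l
    rw [hset _ hν, hset _ hν'] at h1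
    refine h1.trans (add_le_add le_rfl ?_)
    refine le_trans (Finset.sum_le_sum fun s _ => mul_le_of_le_one_left
      ENNReal.toReal_nonneg measureReal_le_one) ?_
    exact h.sum_arms_le (f := fun a => (ν'.armKL ν a).toReal) (fun _ => ENNReal.toReal_nonneg) t
  set q := (S.law ν').real A
  set p := (S.law ν).real A
  have hp : 0 < p := by
    refine lt_of_le_of_ne measureReal_nonneg fun h0 => ?_
    -- if `p = 0`, the inequality `l * q ≤ C` holds for every `l`
    have := key ((C + 1) / q)
    rw [← h0, div_mul_cancel₀ _ hpos.ne'] at this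
    simp at this
    linarith
  refine ⟨hp, ?_⟩
  have h1 := key (-Real.log p)
  rw [Real.exp_neg, Real.exp_log hp] at h1
  have h2 : 1 + (p⁻¹ - 1) * p = 2 - p := by
    rw [sub_mul, inv_mul_cancel₀ hp.ne']
    ring
  have hp1 : p ≤ 1 := measureReal_le_one
  have h3 : Real.log (2 - p) ≤ Real.log 2 := Real.log_le_log (by linarith) (by linarith)
  rw [h2] at h1
  linarith

lemma sum_measure_lt_tau_le_expectedStop (S : Strategy) (ν : BanditModel) (m : ℕ) :
    ∑ s ∈ Finset.range m, S.law ν {ω | (s : ℕ∞) < S.tau ω} ≤ S.expectedStop ν := by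
  have hm := measurableSet_lt_of_isStoppingTime S.isStoppingTime_tau
  calc ∑ s ∈ Finset.range m, S.law ν {ω | (s : ℕ∞) < S.tau ω}
      = ∫⁻ ω, ∑ s ∈ Finset.range m,
          {ω | (s : ℕ∞) < S.tau ω}.indicator (fun _ => (1 : ℝ≥0∞)) ω ∂(S.law ν) := by
        rw [lintegral_finsetSum _ fun s _ => measurable_const.indicator (hm s)]
        simp [lintegral_indicator_const (hm _)]
    _ ≤ S.expectedStop ν := by
        refine lintegral_mono fun ω => ?_
        generalize hτ : S.tau ω = k
        simp only [Set.indicator_apply, Set.mem_ofPred_eq, hτ]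
        cases k with
        | top => simp
        | coe n =>
          simp only [Nat.cast_lt, Finset.sum_boole, ENat.toENNReal_coe]
          have : (Finset.range m).filter (· < n) ⊆ Finset.range n := fun s hs =>
            Finset.mem_range.2 (Finset.mem_filter.1 hs).2
          exact_mod_cast (Finset.card_le_card this).trans_eq (Finset.card_range n)

/-- Since `τ` is even, the draws numbered `2k + 1` and `2k + 2` are made together, so that the
divergence collected by time `2n` is at most `E[τ] / 2` times that of one pair of draws. -/
lemma SamplesUniformly.sum_mul_arms_le {S : Strategy} (h : S.SamplesUniformly) {ν : BanditModel}
    (heven : ∀ᵐ ω ∂(S.law ν), ∃ k : ℕ, S.tau ω = ((2 * k : ℕ) : ℕ∞))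
    (hfin : S.expectedStop ν ≠ ∞) {f : Fin 2 → ℝ} (hf : ∀ a, 0 ≤ f a) (n : ℕ) :
    ∑ s ∈ Finset.range (2 * n), (S.law ν).real {ω | (s : ℕ∞) < S.tau ω} * f (S.arms s) ≤
      (S.expectedStop ν).toReal * ((f 0 + f 1) / 2) := by
  have hpair : ∀ k : ℕ, (S.law ν).real {ω | ((2 * k + 1 : ℕ) : ℕ∞) < S.tau ω} =
      (S.law ν).real {ω | ((2 * k : ℕ) : ℕ∞) < S.tau ω} := by
    intro k
    refine measureReal_congr ?_
    filter_upwards [heven] with ω hω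
    obtain ⟨j, hj⟩ := hω
    refine propext ?_
    change _ < S.tau ω ↔ _ < S.tau ω
    rw [hj, Nat.cast_lt, Nat.cast_lt]
    omega
  have hsum : ∑ s ∈ Finset.range (2 * n), (S.law ν).real {ω | (s : ℕ∞) < S.tau ω} * f (S.arms s) =
      (∑ s ∈ Finset.range (2 * n), (S.law ν).real {ω | (s : ℕ∞) < S.tau ω}) *
        ((f 0 + f 1) / 2) := by
    induction n with
    | zero => simp
    | succ n ih =>
      rw [mul_add_one, Finset.sum_range_succ, Finset.sum_range_succ, Finset.sum_range_succ,
        Finset.sum_range_succ, ih, hpair, ← h.add_arms (2 * n) f]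
      ring
  rw [hsum]
  refine mul_le_mul_of_nonneg_right ?_ (by linarith [hf 0, hf 1])
  have hle := ENNReal.toReal_mono hfin (S.sum_measure_lt_tau_le_expectedStop ν (2 * n))
  rwa [ENNReal.toReal_sum fun s _ => measure_ne_top _ _] at hle

end Strategy

/-! ### A numerical inequality -/

/-- The relative entropy `(1 - 2δ) log ((1 - δ) / δ)` of the Bernoulli distributions with
parameters `1 - δ` and `δ` is at least `log (1 / (2δ))`: the difference is a convex function of
`δ`, which is positive and decreasing at `δ = 0.15`. -/
lemma log_one_div_two_mul_le {δ : ℝ} (h0 : 0 < δ) (h1 : δ ≤ 0.15) :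
    Real.log (1 / (2 * δ)) ≤ (1 - 2 * δ) * Real.log ((1 - δ) / δ) := by
  have hδ1 : 0 < 1 - δ := by linarith
  rw [Real.log_div one_ne_zero (by positivity), Real.log_one, Real.log_mul two_ne_zero h0.ne',
    Real.log_div hδ1.ne' h0.ne']
  -- lower bounds by tangents at `0.15`
  have hx : Real.log 0.15 + 1 - 0.15 / δ ≤ Real.log δ := by
    have := Real.log_le_sub_one_of_pos (x := 0.15 / δ) (by positivity)
    rw [Real.log_div (by norm_num) h0.ne'] at this
    linarith
  have hy : Real.log 0.85 + 1 - 0.85 / (1 - δ) ≤ Real.log (1 - δ) := by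
    have := Real.log_le_sub_one_of_pos (x := 0.85 / (1 - δ)) (by positivity)
    rw [Real.log_div (by norm_num) hδ1.ne'] at this
    linarith
  have hx' : 2 * δ * Real.log 0.15 + 2 * δ - 0.3 ≤ 2 * δ * Real.log δ := by
    have := mul_le_mul_of_nonneg_left hx (by positivity : 0 ≤ 2 * δ)
    have e : 2 * δ * (Real.log 0.15 + 1 - 0.15 / δ) = 2 * δ * Real.log 0.15 + 2 * δ - 0.3 := by
      field_simp
      ring
    linarith
  have hy' : (1 - 2 * δ) * Real.log 0.85 ≤ (1 - 2 * δ) * Real.log (1 - δ) := by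
    refine mul_le_mul_of_nonneg_left (le_trans ?_ hy) (by linarith)
    have : 0.85 / (1 - δ) ≤ 1 := (div_le_one hδ1).2 (by linarith)
    linarith
  have hval : 0 ≤ 7 * Real.log 0.85 + 3 * Real.log 0.15 + 10 * Real.log 2 := by
    have e : 7 * Real.log 0.85 + 3 * Real.log 0.15 + 10 * Real.log 2 =
        Real.log (0.85 ^ 7 * 0.15 ^ 3 * 2 ^ 10) := by
      rw [Real.log_mul (by norm_num) (by norm_num), Real.log_mul (by norm_num) (by norm_num),
        Real.log_pow, Real.log_pow, Real.log_pow]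
      norm_num
    rw [e]
    exact Real.log_nonneg (by norm_num)
  have hslope : 1 ≤ Real.log 0.85 - Real.log 0.15 := by
    rw [← Real.log_div (by norm_num) (by norm_num), Real.le_log_iff_exp_le (by norm_num)]
    exact Real.exp_one_lt_d9.le.trans (by norm_num)
  nlinarith [mul_nonneg (sub_nonneg.2 h1) (sub_nonneg.2 hslope)]

/-! ### Bounds against one alternative model -/

open BanditModel in
/-- The fixed-budget bound against one alternative model. -/
lemma limsup_errorProb_le {M : Set BanditModel} (hid : Identifiable M) {ν ν' : BanditModel}
    (hν : ν ∈ M) (hν' : ν' ∈ M) (hμ : ν.mean 1 < ν.mean 0) (hμ' : ν'.mean 0 < ν'.mean 1)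
    {S : ℕ → Strategy} (hS : IsFixedBudget S M) (hunif : ∀ t, (S t).SamplesUniformly)
    (hcons : IsConsistent S M) :
    limsup (fun t : ℕ => -(1 / (t : EReal)) * ENNReal.log ((S t).errorProb ν)) atTop ≤
      (((ν'.armKL ν 0 + ν'.armKL ν 1) / 2 : ℝ≥0∞) : EReal) := by
  have hKL := fun a => hid.armKL_ne_top hν' hν a
  set A : ℕ → Set (ℕ → ℝ) := fun t => {ω | (S t).recommend ω = 1} with hAdef
  have hA : ∀ t, MeasurableSet[(S t).isStoppingTime_tau.measurableSpace] (A t) := fun t =>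
    (S t).measurableSet_recommend_eq 1
  set q : ℕ → ℝ := fun t => ((S t).law ν').real (A t)
  set K : ℝ := (ν'.armKL ν 0).toReal + (ν'.armKL ν 1).toReal with hKdef
  have hp : ∀ t, (S t).errorProb ν = (S t).law ν (A t) := by
    intro t
    rw [Strategy.errorProb, bestArm_eq_zero hμ]
    congr 1
    ext ω
    simp only [hAdef, Set.mem_ofPred_eq]
    omega
  have hq : Tendsto q atTop (nhds 1) := by
    have h1 := (ENNReal.tendsto_toReal ENNReal.zero_ne_top).comp (hcons ν' hν')
    have h2 := h1.const_sub 1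
    simp only [ENNReal.toReal_zero, sub_zero] at h2
    refine h2.congr fun t => ?_
    have hm := (S t).isStoppingTime_tau.measurableSpace_le _ (hA t)
    have hc := probReal_compl_eq_one_sub (μ := (S t).law ν') hm
    rw [Function.comp_apply, Strategy.errorProb, bestArm_eq_one hμ']
    change 1 - ((S t).law ν').real (A t)ᶜ = q t
    rw [hc]
    ring
  have hlim : Tendsto (fun t : ℕ => (Real.log 2 / t + (1 + 1 / (t : ℝ)) / 2 * K) / q t) atTop
      (nhds (K / 2)) := by
    have h1 : Tendsto (fun t : ℕ => Real.log 2 / (t : ℝ)) atTop (nhds 0) :=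
      tendsto_const_div_atTop_nhds_zero_nat _
    have h2 : Tendsto (fun t : ℕ => 1 / (t : ℝ)) atTop (nhds 0) :=
      tendsto_const_div_atTop_nhds_zero_nat _
    have h3 := (h1.add (((h2.const_add 1).div_const 2).mul_const K)).div hq one_ne_zero
    have e : (0 + (1 + 0) / 2 * K) / 1 = K / 2 := by ring
    rw [e] at h3
    exact h3
  have hcoe : (((ν'.armKL ν 0 + ν'.armKL ν 1) / 2 : ℝ≥0∞) : EReal) = ((K / 2 : ℝ) : EReal) := by
    have hne : (ν'.armKL ν 0 + ν'.armKL ν 1) / 2 ≠ ∞ :=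
      ENNReal.div_ne_top (ENNReal.add_ne_top.2 ⟨hKL 0, hKL 1⟩) two_ne_zero
    rw [← EReal.coe_ennreal_toReal hne, ENNReal.toReal_div, ENNReal.toReal_add (hKL 0) (hKL 1)]
    rfl
  rw [hcoe, ← ((continuous_coe_real_ereal.tendsto _).comp hlim).limsup_eq]
  refine limsup_le_limsup ?_
  filter_upwards [hq.eventually (lt_mem_nhds zero_lt_one), eventually_gt_atTop 0] with t hqt ht
  have htr : (0 : ℝ) < t := by exact_mod_cast ht
  obtain ⟨hpos, hle⟩ := (hunif t).neg_log_measureReal_le hKL (hA t) (hS t ν hν) (hS t ν' hν') hqt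
  have hlog : ENNReal.log ((S t).errorProb ν) = Real.log (((S t).law ν).real (A t)) := by
    rw [hp]
    exact ENNReal.log_pos_real' hpos
  rw [hlog, Function.comp_apply]
  have hcast : -(1 / (t : EReal)) * (Real.log (((S t).law ν).real (A t)) : EReal) =
      ((-(1 / (t : ℝ)) * Real.log (((S t).law ν).real (A t)) : ℝ) : EReal) := by
    push_cast
    rfl
  rw [hcast, EReal.coe_le_coe_iff, le_div_iff₀ hqt]
  have e : -(1 / (t : ℝ)) * Real.log (((S t).law ν).real (A t)) * q t =
      (q t * -Real.log (((S t).law ν).real (A t))) / t := by ring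
  rw [e, div_le_iff₀ htr]
  refine hle.trans_eq ?_
  rw [← hKdef]
  field_simp

open BanditModel in
/-- The fixed-confidence bound against one alternative model. -/
lemma log_le_expectedStop_mul {M : Set BanditModel} (hid : Identifiable M) {ν ν' : BanditModel}
    (hν : ν ∈ M) (hν' : ν' ∈ M) (hμ : ν.mean 1 < ν.mean 0) (hμ' : ν'.mean 0 < ν'.mean 1)
    {δ : ℝ} (h0 : 0 < δ) (h1 : δ ≤ 0.15) {S : Strategy} (hfin : S.TerminatesOn M)
    (hunif : S.SamplesUniformly) (heven : S.StopsAfterPairs M) (hpac : S.IsPAC M δ)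
    (hE : S.expectedStop ν ≠ ∞) :
    Real.log (1 / (2 * δ)) ≤
      (S.expectedStop ν).toReal * (((ν.armKL ν' 0).toReal + (ν.armKL ν' 1).toReal) / 2) := by
  have hKL := fun a => hid.armKL_ne_top hν hν' a
  set A : Set (ℕ → ℝ) := {ω | S.recommend ω = 0} with hAdef
  have hA := S.measurableSet_recommend_eq 0
  have hAm : MeasurableSet A := S.isStoppingTime_tau.measurableSpace_le _ hA
  have hP : 1 - δ ≤ (S.law ν).real A := by
    have h := hpac ν hν
    rw [bestArm_eq_zero hμ, ENNReal.ofReal_le_iff_le_toReal (measure_ne_top _ _)] at h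
    exact h
  have hQ : (S.law ν').real A ≤ δ := by
    have h := hpac ν' hν'
    rw [bestArm_eq_one hμ', ENNReal.ofReal_le_iff_le_toReal (measure_ne_top _ _)] at h
    have hset : {ω | S.recommend ω = 1} = Aᶜ := by
      ext ω
      simp only [hAdef, Set.mem_ofPred_eq, Set.mem_compl_iff]
      omega
    rw [hset] at h
    change 1 - δ ≤ (S.law ν').real Aᶜ at h
    rw [probReal_compl_eq_one_sub hAm] at h
    linarith
  set C := (S.expectedStop ν).toReal * (((ν.armKL ν' 0).toReal + (ν.armKL ν' 1).toReal) / 2)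
  -- the slope of the relative entropy with second parameter `δ` at the first parameter `1 - δ`
  set l := 2 * Real.log ((1 - δ) / δ) with hl
  have hδ1 : 0 < 1 - δ := by linarith
  have hratio : 0 ≤ Real.log ((1 - δ) / δ) :=
    Real.log_nonneg ((one_le_div h0).2 (by linarith))
  have hexp : Real.exp l = ((1 - δ) / δ) ^ 2 := by
    rw [hl, two_mul, Real.exp_add, Real.exp_log (by positivity), sq]
  have hbound : ∀ n : ℕ, l * (S.law ν).real (A ∩ {ω | S.tau ω ≤ (2 * n : ℕ)}) ≤
      Real.log ((1 - δ) / δ) + C := by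
    intro n
    refine (hunif.mul_measureReal_le hKL hA (2 * n) l).trans (add_le_add ?_ ?_)
    · have hel : 1 ≤ Real.exp l := Real.one_le_exp (by positivity)
      have hle : (S.law ν').real (A ∩ {ω | S.tau ω ≤ (2 * n : ℕ)}) ≤ δ :=
        (measureReal_mono Set.inter_subset_left).trans hQ
      refine Real.log_le_log ?_ ?_
      · have := mul_nonneg (sub_nonneg.2 hel) (measureReal_nonneg (μ := S.law ν')
          (s := A ∩ {ω | S.tau ω ≤ (2 * n : ℕ)}))
        linarith
      · calc _ ≤ 1 + (Real.exp l - 1) * δ := by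
              gcongr
          _ = (1 - δ) / δ := by
              rw [hexp]
              field_simp
              ring
    · exact hunif.sum_mul_arms_le (heven ν hν) hE
        (f := fun a => (ν.armKL ν' a).toReal) (fun _ => ENNReal.toReal_nonneg) n
  have hlim : Tendsto (fun n : ℕ => (S.law ν).real (A ∩ {ω | S.tau ω ≤ (2 * n : ℕ)})) atTop
      (nhds ((S.law ν).real A)) := by
    have hmono : Monotone fun n : ℕ => A ∩ {ω | S.tau ω ≤ (2 * n : ℕ)} := fun m n hmn ω hω =>
      ⟨hω.1, (show S.tau ω ≤ (2 * m : ℕ) from hω.2).trans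
        (Nat.cast_le.2 (Nat.mul_le_mul_left 2 hmn))⟩
    have hae : (S.law ν) (⋃ n : ℕ, A ∩ {ω | S.tau ω ≤ (2 * n : ℕ)}) = S.law ν A := by
      refine measure_congr ?_
      filter_upwards [hfin ν hν] with ω hω
      refine propext ⟨fun h => ?_, fun h => ?_⟩
      · obtain ⟨n, hn⟩ := Set.mem_iUnion.1 h
        exact hn.1
      · obtain ⟨k, hk⟩ := ENat.ne_top_iff_exists.1 hω.ne
        refine Set.mem_iUnion.2 ⟨k, h, ?_⟩
        change S.tau ω ≤ _
        rw [← hk]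
        exact_mod_cast (by omega : k ≤ 2 * k)
    have := tendsto_measure_iUnion_atTop (μ := S.law ν) hmono
    rw [hae] at this
    exact (ENNReal.tendsto_toReal (measure_ne_top _ _)).comp this
  have hfinal : l * (S.law ν).real A ≤ Real.log ((1 - δ) / δ) + C :=
    le_of_tendsto' (hlim.const_mul l) hbound
  have hl' : l * (1 - δ) ≤ l * (S.law ν).real A :=
    mul_le_mul_of_nonneg_left hP (by positivity)
  have := log_one_div_two_mul_le h0 h1
  simp only [hl] at hfinal hl'
  linarith

/-! ### The infimum over the alternatives -/

theorem theorem2 (M : Set BanditModel) (hM : BanditModel.HasUniqueBestArm M)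
    (hid : BanditModel.Identifiable M) (ν : BanditModel) (hν : ν ∈ M)
    (hμ : ν.mean 1 < ν.mean 0) :
    (∀ S : ℕ → Strategy, IsFixedBudget S M → (∀ t, (S t).SamplesUniformly) →
      IsConsistent S M →
        limsup (fun t : ℕ => -(1 / (t : EReal)) * ENNReal.log ((S t).errorProb ν)) atTop
          ≤ (BanditModel.upperI M ν : EReal)) ∧
    (∀ (δ : ℝ) (S : Strategy), 0 < δ → δ ≤ 0.15 → S.TerminatesOn M → S.SamplesUniformly →
      S.StopsAfterPairs M → S.IsPAC M δ →
        1 / BanditModel.lowerI M ν * ENNReal.ofReal (Real.log (1 / (2 * δ)))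
          ≤ S.expectedStop ν) := by
  refine ⟨fun S hS hunif hcons => ?_, fun δ S h0 h1 hfin hunif heven hpac => ?_⟩
  · refine ((le_max_right 0 _).trans_eq EReal.coe_toENNReal_eq_max.symm).trans
      (EReal.coe_ennreal_le_coe_ennreal_iff.2 ?_)
    refine le_iInf₂ fun ν' hν' => ?_
    have h := EReal.toENNReal_le_toENNReal
      (limsup_errorProb_le hid hν hν'.1 hμ hν'.2 hS hunif hcons)
    rwa [EReal.toENNReal_coe] at h
  · rcases eq_or_ne (S.expectedStop ν) ∞ with hE | hE
    · rw [hE]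
      exact le_top
    set L := ENNReal.ofReal (Real.log (1 / (2 * δ))) with hL
    have hLpos : 0 < L := ENNReal.ofReal_pos.2 (Real.log_pos (by
      rw [lt_div_iff₀ (by positivity)]
      linarith))
    have hI : L / S.expectedStop ν ≤ BanditModel.lowerI M ν := by
      refine le_iInf₂ fun ν' hν' => ENNReal.div_le_of_le_mul' ?_
      have hK := fun a => hid.armKL_ne_top hν hν'.1 a
      have hne : (ν.armKL ν' 0 + ν.armKL ν' 1) / 2 ≠ ∞ :=
        ENNReal.div_ne_top (ENNReal.add_ne_top.2 ⟨hK 0, hK 1⟩) two_ne_zero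
      rw [hL, ENNReal.ofReal_le_iff_le_toReal (ENNReal.mul_ne_top hE hne), ENNReal.toReal_mul,
        ENNReal.toReal_div, ENNReal.toReal_add (hK 0) (hK 1)]
      exact log_le_expectedStop_mul hid hν hν'.1 hμ hν'.2 h0 h1 hfin hunif heven hpac hE
    rw [one_div, mul_comm, ← div_eq_mul_inv]
    rcases eq_or_ne (S.expectedStop ν) 0 with hE0 | hE0
    · -- if `E[τ] = 0` there is no alternative model, and the infimum is `∞`
      rw [hE0, ENNReal.div_zero hLpos.ne', top_le_iff] at hI
      simp [hI]
    · refine ENNReal.div_le_of_le_mul' ?_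
      rwa [ENNReal.div_le_iff hE0 hE] at hI
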